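/- Theorem 1.3. Let $\mathfrak b$ be the least cardinality of a subset of $\omega^\omega$ that is unbounded with respect to $\le^*$, where $f \le^* g$ means that $f(n) \le g(n)$ for all but finitely many $n$. Let $\mathfrak p$ be the least cardinality of a family $\mathcal F$ of subsets of $\omega$ such that every finite subfamily of $\mathcal F$ has infinite intersection, but there is no infinite $P \subseteq \omega$ for which $P \setminus S$ is finite for all $S \in \mathcal F$. Assume $\mathfrak p = \mathfrak b$. Then there is a countable Hausdorff zero-dimensional Fréchet–Urysohn space $X$ that is not H-separable and has $\pi$-weight exactly $\mathfrak b$. Here $X$ is zero-dimensional if its clopen sets form a base; it is Fréchet–Urysohn if whenever $A \subseteq X$ and $x \in \overline{A}$, some sequence of points of $A$ converges to $x$; and it is H-separable if for every sequence $(D_n)_{n\in\omega}$ of dense subsets of $X$ there are finite sets $F_n \subseteq D_n$ such that $\bigcup_{n \in A} F_n$ is dense in $X$ for every infinite $A \subseteq \omega$. The $\pi$-weight of $X$ is the least cardinality of a $\pi$-base, that is, of a family of nonempty open sets such that every nonempty open set contains a member of the family. -/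

import Mathlib

open Filter Set TopologicalSpace

/-- The family `F` of functions `ℕ → ℕ` is unbounded for eventual domination:
no single function `g` satisfies `f ≤* g` for every `f ∈ F`. -/
def UnboundedFamily (F : Set (ℕ → ℕ)) : Prop :=
  ¬ ∃ g : ℕ → ℕ, ∀ f ∈ F, ∀ᶠ n in atTop, f n ≤ g n

/-- The bounding number `𝔟`: the least cardinality of an unbounded family in `ω^ω`. -/
noncomputable def boundingNumber : Cardinal.{0} :=
  sInf {κ | ∃ F : Set (ℕ → ℕ), UnboundedFamily F ∧ Cardinal.mk F = κ}

/-- The strong finite intersection property: the intersection of any finite subfamily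
is infinite. (In particular every member of the family is infinite.) -/
def HasSFIP (F : Set (Set ℕ)) : Prop :=
  ∀ G : Set (Set ℕ), G ⊆ F → G.Finite → (⋂₀ G).Infinite

/-- `P` is a pseudointersection of `F`: it is infinite and almost contained in each
member of `F`. -/
def IsPseudointersection (P : Set ℕ) (F : Set (Set ℕ)) : Prop :=
  P.Infinite ∧ ∀ S ∈ F, (P \ S).Finite

/-- The pseudointersection number `𝔭`: the least cardinality of a family of subsets of `ℕ`
with the strong finite intersection property and without a pseudointersection. -/
noncomputable def pseudointersectionNumber : Cardinal.{0} :=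
  sInf {κ | ∃ F : Set (Set ℕ),
    HasSFIP F ∧ (¬ ∃ P : Set ℕ, IsPseudointersection P F) ∧ Cardinal.mk F = κ}

universe u

/-- A π-base of a space: a family of nonempty open sets such that every nonempty open set
contains a member of the family. -/
def IsPiBase (X : Type u) [TopologicalSpace X] (B : Set (Set X)) : Prop :=
  (∀ U ∈ B, IsOpen U ∧ U.Nonempty) ∧
    ∀ W : Set X, IsOpen W → W.Nonempty → ∃ U ∈ B, U ⊆ W

/-- The π-weight of a space: the least cardinality of a π-base. -/
noncomputable def piWeight (X : Type u) [TopologicalSpace X] : Cardinal.{u} :=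
  sInf {κ | ∃ B : Set (Set X), IsPiBase X B ∧ Cardinal.mk B = κ}

/-- A space is zero-dimensional if its clopen sets form a base of the topology. -/
def IsZeroDimensional (X : Type u) [TopologicalSpace X] : Prop :=
  IsTopologicalBasis {s : Set X | IsClopen s}

/-- A space is H-separable if for every sequence `D 0, D 1, …` of dense sets there are finite
sets `F n ⊆ D n` such that `⋃ n ∈ A, F n` is dense for every infinite set `A` of indices. -/
def HSeparable (X : Type u) [TopologicalSpace X] : Prop :=
  ∀ D : ℕ → Set X, (∀ n, Dense (D n)) →
    ∃ F : ℕ → Finset X, (∀ n, (F n : Set X) ⊆ D n) ∧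
      ∀ A : Set ℕ, A.Infinite → Dense (⋃ n ∈ A, (F n : Set X))

/-! ### The cardinals `𝔟` and `𝔭` -/

/-! From `𝔭 = 𝔟` one builds a tower `y` of length `𝔟`: at each stage a pseudointersection of the
earlier sets is thinned to outgrow the next member of an unbounded family, so every interval
partition has infinitely many blocks missed by some `y α` (`exists_isUnboundedTower`).

The points of the space are finite sequences of pairs. Its two-valued coordinates record the initial
parts of a point, which already separate points, and, for each `γ`, whether `Holds (y γ)`. The
latter fails when the last entry `(n, m)` has `n ∈ y γ` and `y γ` misses the interval from `n` to
the height of the point; otherwise the value is inherited from an earlier part.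

H-separability fails for the dense sets `D n` of sequences whose last entry begins with `n`. Given
finite `F n ⊆ D n`, gaps of some `y α` yield infinitely many `n ∈ y α` such that `Holds (y α)` fails
on all of `F n`, although it holds at the empty sequence (`TowerSpace.not_hSeparable`).

For the Fréchet–Urysohn property, a gap of `y γ` ending at the height of a point near `S` forces the
`γ`-th coordinate to agree with that of `S` (`holds_append_iff`). `𝔭` handles initial segments of
coordinates, unboundedness produces gaps, and a diagonal sequence bounded via `𝔟` handles all
coordinates at once (`IsUnboundedTower.exists_seq_eventually_mem`).

Counting basic clopen sets bounds the π-weight above by `𝔟`; the lower bound holds because countable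
spaces of smaller π-weight are H-separable. -/

theorem exists_eventual_bound {I : Type} (hI : Cardinal.mk I < boundingNumber) (f : I → ℕ → ℕ) :
    ∃ g : ℕ → ℕ, ∀ i, ∀ᶠ n in atTop, f i n ≤ g n := by
  by_contra hf
  refine absurd hI (not_lt.mpr ?_)
  refine le_trans (csInf_le' ⟨range f, ?_, rfl⟩) Cardinal.mk_range_le
  rintro ⟨g, hg⟩
  exact hf ⟨g, fun i => hg _ (mem_range_self i)⟩

theorem exists_unboundedFamily :
    ∃ F : Set (ℕ → ℕ), UnboundedFamily F ∧ Cardinal.mk F = boundingNumber := by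
  refine csInf_mem (s := {κ | ∃ F : Set (ℕ → ℕ), UnboundedFamily F ∧ Cardinal.mk F = κ})
    ⟨_, univ, ?_, rfl⟩
  rintro ⟨g, hg⟩
  obtain ⟨n, hn⟩ := (hg (fun n => g n + 1) (mem_univ _)).exists
  omega

theorem aleph0_lt_boundingNumber : Cardinal.aleph0 < boundingNumber := by
  obtain ⟨F, hF, hcard⟩ := exists_unboundedFamily
  by_contra hle
  have hc : F.Countable := by
    rw [← Cardinal.le_aleph0_iff_set_countable, hcard]
    exact not_lt.mp hle
  apply hF
  rcases F.eq_empty_or_nonempty with rfl | hne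
  · exact ⟨0, by simp⟩
  obtain ⟨u, rfl⟩ := hc.exists_eq_range hne
  refine ⟨fun n => (Finset.range (n + 1)).sup fun i => u i n, ?_⟩
  rintro _ ⟨i, rfl⟩
  filter_upwards [eventually_ge_atTop i] with n hn
  exact Finset.le_sup (f := fun i => u i n) (Finset.mem_range.mpr (by omega))

theorem mk_Iio_ord_toType_lt {c : Cardinal.{0}} (α : c.ord.ToType) : Cardinal.mk (Iio α) < c := by
  simpa using Cardinal.mk_Iio_lt α (by simp)

theorem exists_unbounded_indexed :
    ∃ f : boundingNumber.ord.ToType → ℕ → ℕ,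
      ¬ ∃ g : ℕ → ℕ, ∀ i, ∀ᶠ n in atTop, f i n ≤ g n := by
  obtain ⟨F, hF, hcard⟩ := exists_unboundedFamily
  obtain ⟨e⟩ : Nonempty (boundingNumber.ord.ToType ≃ F) := by
    rw [← Cardinal.eq, hcard, Cardinal.mk_ord_toType]
  refine ⟨fun i => e i, ?_⟩
  rintro ⟨g, hg⟩
  refine hF ⟨g, fun f hf => ?_⟩
  simpa using hg (e.symm ⟨f, hf⟩)

theorem exists_isPseudointersection {F : Set (Set ℕ)}
    (hF : Cardinal.mk F < pseudointersectionNumber) (h : HasSFIP F) :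
    ∃ P, IsPseudointersection P F := by
  by_contra hP
  exact absurd hF (not_lt.mpr (csInf_le' ⟨F, h, hP, rfl⟩))

/-- Fewer than `𝔭` subsets of a countable set with infinite finite intersections all contain
almost all terms of one injective sequence. -/
theorem exists_injective_seq_eventually_mem {X I : Type} [Countable X] [Infinite X]
    (hI : Cardinal.mk I < pseudointersectionNumber) (S : I → Set X)
    (hS : ∀ t : Finset I, (⋂ i ∈ t, S i).Infinite) :
    ∃ a : ℕ → X, Function.Injective a ∧ ∀ i, ∀ᶠ j in atTop, a j ∈ S i := by
  obtain ⟨_⟩ := nonempty_denumerable X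
  let e : X ≃ ℕ := Denumerable.eqv X
  obtain ⟨P, hP, hPS⟩ : ∃ P, IsPseudointersection P (range fun i => e '' S i) := by
    refine exists_isPseudointersection (Cardinal.mk_range_le.trans_lt hI) ?_
    intro G hG hfin
    classical
    obtain ⟨t, ht⟩ : ∃ t : Finset I, G ⊆ (fun i => e '' S i) '' (t : Set I) := by
      obtain ⟨t, ht, rfl⟩ := Set.subset_range_iff_exists_image_eq.mp hG
      obtain ⟨t', -, hbij⟩ := Set.exists_subset_bijOn t (fun i => e '' S i)
      have : t'.Finite := by
        apply Set.Finite.of_finite_image _ hbij.injOn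
        rwa [hbij.image_eq]
      exact ⟨this.toFinset, by rw [this.coe_toFinset, hbij.image_eq]⟩
    refine ((hS t).image e.injective.injOn).mono ?_
    rintro _ ⟨x, hx, rfl⟩ s hs
    obtain ⟨i, hi, rfl⟩ := ht hs
    exact mem_image_of_mem _ (mem_iInter₂.mp hx i hi)
  refine ⟨fun j => e.symm (Nat.nth (· ∈ P) j),
    e.symm.injective.comp (Nat.nth_injective hP), fun i => ?_⟩
  have hfin := (hPS _ (mem_range_self i)).preimage (f := Nat.nth (· ∈ P)) (Nat.nth_injective hP).injOn
  have := hfin.compl_mem_cofinite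
  rw [Nat.cofinite_eq_atTop] at this
  filter_upwards [this] with j hj
  by_contra hcon
  refine hj ⟨Nat.nth_mem_of_infinite hP j, ?_⟩
  rintro ⟨x, hx, hxj⟩
  apply hcon
  have hx' : x = e.symm (Nat.nth (· ∈ P) j) := by rw [← hxj, e.symm_apply_apply]
  rwa [← hx']

/-! ### Unbounded towers -/

/-- A sequence of infinite sets that is decreasing modulo finite sets, such that every partition
of `ℕ` into intervals has infinitely many blocks disjoint from one of the sets. -/
structure IsUnboundedTower {ι : Type} [LinearOrder ι] (y : ι → Set ℕ) : Prop where
  infinite : ∀ α, (y α).Infinite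
  finite_diff : ∀ ⦃α β⦄, α ≤ β → (y β \ y α).Finite
  exists_gaps : ∀ i : ℕ → ℕ, StrictMono i →
    ∃ α, ∃ᶠ j in atTop, Disjoint (y α) (Ico (i j) (i (j + 1)))

/-- Consecutive elements of `P` are so far apart that they outgrow `f`. -/
def OutgrowsFun (P : Set ℕ) (f : ℕ → ℕ) : Prop :=
  ∀ m ∈ P, ∀ m' ∈ P, m < m' → ∀ n ≤ m, f n ≤ m'

theorem exists_subset_outgrowsFun {P : Set ℕ} (hP : P.Infinite) (f : ℕ → ℕ) :
    ∃ Q ⊆ P, Q.Infinite ∧ OutgrowsFun Q f := by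
  have step : ∀ m : ℕ, ∃ m' ∈ P, m < m' ∧ ∀ n ≤ m, f n ≤ m' := by
    intro m
    obtain ⟨m', hm', hlt⟩ := hP.exists_gt (m + (Finset.range (m + 1)).sup f)
    refine ⟨m', hm', by omega, fun n hn => ?_⟩
    have : f n ≤ (Finset.range (m + 1)).sup f :=
      Finset.le_sup (f := f) (Finset.mem_range.mpr (Nat.lt_succ_of_le hn : n < m + 1))
    omega
  choose s hsP hlt hs using step
  let u : ℕ → ℕ := fun k => s^[k + 1] 0
  have hu : ∀ k, u (k + 1) = s (u k) := fun k => Function.iterate_succ_apply' s (k + 1) 0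
  have hmono : StrictMono u := strictMono_nat_of_lt_succ fun k => by
    rw [hu]; exact hlt _
  refine ⟨range u, ?_, infinite_range_of_injective hmono.injective, ?_⟩
  · rintro _ ⟨k, rfl⟩
    change s^[k + 1] 0 ∈ P
    rw [Function.iterate_succ_apply']
    exact hsP _
  · rintro _ ⟨k, rfl⟩ _ ⟨l, rfl⟩ hkl n hn
    have hl : u (k + 1) ≤ u l := hmono.monotone (hmono.lt_iff_lt.mp hkl)
    rw [hu] at hl
    exact (hs _ _ hn).trans hl

theorem exists_gaps_of_outgrows {ι : Type} {y : ι → Set ℕ} {f : ι → ℕ → ℕ}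
    (hf : ¬ ∃ g : ℕ → ℕ, ∀ i, ∀ᶠ n in atTop, f i n ≤ g n)
    (hy : ∀ α, OutgrowsFun (y α) (f α)) (i : ℕ → ℕ) (hi : StrictMono i) :
    ∃ α, ∃ᶠ j in atTop, Disjoint (y α) (Ico (i j) (i (j + 1))) := by
  by_contra! hcon
  -- If `y α` meets blocks `n` and `n + 1` in `m < m'`, then `f α n ≤ m' < i (n + 2)`.
  refine hf ⟨fun n => i (n + 2), fun α => ?_⟩
  have h := hcon α
  rw [eventually_atTop] at h
  obtain ⟨N, hN⟩ := h
  filter_upwards [eventually_ge_atTop N] with n hn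
  obtain ⟨m, hm, hm1⟩ := not_disjoint_iff.mp (hN n hn)
  obtain ⟨m', hm', hm1'⟩ := not_disjoint_iff.mp (hN (n + 1) (by omega))
  have h1 : n ≤ m := hi.le_apply.trans hm1.1
  have h2 : m < m' := hm1.2.trans_le hm1'.1
  exact (hy α m hm m' hm' h2 n h1).trans hm1'.2.le

theorem exists_isUnboundedTower (h : pseudointersectionNumber = boundingNumber) :
    ∃ y : boundingNumber.ord.ToType → Set ℕ, IsUnboundedTower y := by
  classical
  obtain ⟨f, hf⟩ := exists_unbounded_indexed
  let Good : (α : boundingNumber.ord.ToType) → (Iio α → Set ℕ) → Set ℕ → Prop :=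
    fun α z P => P.Infinite ∧ (∀ β, (P \ z β).Finite) ∧ OutgrowsFun P (f α)
  let y : boundingNumber.ord.ToType → Set ℕ :=
    wellFounded_lt.fix fun α z =>
      -- The default `univ` is never taken: `key` shows that a good set exists at every stage.
      if hz : ∃ P, Good α (fun β => z β.1 β.2) P then hz.choose else univ
  have hy : ∀ α, y α = if hz : ∃ P, Good α (fun β => y β.1) P then hz.choose else univ :=
    fun α => wellFounded_lt.fix_eq _ α
  have key : ∀ α, Good α (fun β => y β.1) (y α) := by
    intro α
    refine wellFounded_lt.induction (C := fun α => Good α (fun β => y β.1) (y α)) α ?_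
    intro α ih
    suffices hex : ∃ P, Good α (fun β => y β.1) P by
      rw [hy α, dif_pos hex]
      exact hex.choose_spec
    obtain ⟨P, hP, hPy⟩ : ∃ P, IsPseudointersection P (range fun β : Iio α => y β.1) := by
      refine exists_isPseudointersection ?_ ?_
      · rw [h]
        exact Cardinal.mk_range_le.trans_lt (mk_Iio_ord_toType_lt α)
      · intro G hG hfin
        -- A finite part of a chain modulo finite sets has a last member, almost contained in all
        -- the others.
        have hlast : ∀ G : Set (Set ℕ), G.Finite → G ⊆ range (fun β : Iio α => y β.1) →
            G = ∅ ∨ ∃ β : Iio α, ∀ s ∈ G, (y β.1 \ s).Finite := by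
          intro G hfin
          induction G, hfin using Set.Finite.induction_on with
          | empty => simp
          | @insert s G _ _ ihG =>
            intro hsub
            right
            obtain ⟨γ, rfl⟩ := hsub (mem_insert _ _)
            rcases ihG ((subset_insert _ _).trans hsub) with rfl | ⟨β, hβ⟩
            · exact ⟨γ, by simp⟩
            · rcases lt_trichotomy γ.1 β.1 with hlt | heq | hlt
              · refine ⟨β, ?_⟩
                rintro s (rfl | hs)
                · exact (ih β.1 β.2).2.1 ⟨γ.1, hlt⟩
                · exact hβ s hs
              · refine ⟨β, ?_⟩
                rintro s (rfl | hs)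
                · simp [heq]
                · exact hβ s hs
              · refine ⟨γ, ?_⟩
                rintro s (rfl | hs)
                · simp
                · refine (((ih γ.1 γ.2).2.1 ⟨β.1, hlt⟩).union (hβ s hs)).subset ?_
                  intro n hn
                  by_cases hb : n ∈ y β.1
                  · exact Or.inr ⟨hb, hn.2⟩
                  · exact Or.inl ⟨hn.1, hb⟩
        rcases hlast G hfin hG with rfl | ⟨β, hβ⟩
        · simpa using infinite_univ
        · have hfin' : (⋃ s ∈ G, y β.1 \ s).Finite := hfin.biUnion hβ
          refine ((ih β.1 β.2).1.sdiff hfin').mono ?_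
          rintro n ⟨hn, hn'⟩ s hs
          by_contra hns
          exact hn' (mem_biUnion hs ⟨hn, hns⟩)
    obtain ⟨Q, hQP, hQ, hQf⟩ := exists_subset_outgrowsFun hP (f α)
    exact ⟨Q, hQ, fun β => (hPy _ (mem_range_self β)).subset (sdiff_subset_sdiff_left hQP), hQf⟩
  refine ⟨y, fun α => (key α).1, fun α β hαβ => ?_,
    exists_gaps_of_outgrows hf fun α => (key α).2.2⟩
  rcases hαβ.eq_or_lt with rfl | hlt
  · simp
  · exact (key β).2.1 ⟨α, hlt⟩

namespace IsUnboundedTower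

variable {ι : Type} [LinearOrder ι] {y : ι → Set ℕ}

/-- The intervals `[l j, h j)` may overlap, so a partition is built in which each block contains one
of them. -/
theorem exists_gaps_along (hy : IsUnboundedTower y) {l h : ℕ → ℕ} (hl : Tendsto l atTop atTop) :
    ∃ α, ∃ᶠ j in atTop, Disjoint (y α) (Ico (l j) (h j)) := by
  have hJ : ∀ m, ∃ j, m ≤ j ∧ m ≤ l j := fun m =>
    ((eventually_ge_atTop m).and (hl.eventually_ge_atTop m)).exists
  choose J hJ hlJ using hJ
  let i : ℕ → ℕ := fun k => Nat.rec 0 (fun _ m => max (m + 1) (h (J m))) k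
  have hi : ∀ k, i (k + 1) = max (i k + 1) (h (J (i k))) := fun k => rfl
  have hmono : StrictMono i := strictMono_nat_of_lt_succ fun k => by rw [hi]; omega
  obtain ⟨α, hα⟩ := hy.exists_gaps i hmono
  refine ⟨α, ?_⟩
  rw [frequently_atTop] at hα ⊢
  intro N
  obtain ⟨k, hk, hdisj⟩ := hα N
  refine ⟨J (i k), (hk.trans hmono.le_apply).trans (hJ _), hdisj.mono_right ?_⟩
  exact Ico_subset_Ico (hlJ _) (by rw [hi]; exact le_max_right _ _)

theorem eventually_disjoint (hy : IsUnboundedTower y) {α β : ι} (hαβ : α ≤ β) :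
    ∃ M, ∀ l h, M ≤ l → Disjoint (y α) (Ico l h) → Disjoint (y β) (Ico l h) := by
  obtain ⟨M, hM⟩ := (hy.finite_diff hαβ).bddAbove
  refine ⟨M + 1, fun l h hl hd => ?_⟩
  rw [Set.disjoint_left] at hd ⊢
  intro n hn hnl
  by_cases hα : n ∈ y α
  · exact hd hα hnl
  · have := hM ⟨hn, hα⟩
    have := hnl.1
    omega

/-- Countable subsets of the index set of an unbounded tower are bounded. -/
theorem exists_forall_lt (hy : IsUnboundedTower y)
    (hp : Cardinal.aleph0 < pseudointersectionNumber) (u : ℕ → ι) (hu : Monotone u) :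
    ∃ δ, ∀ i, u i < δ := by
  by_contra! hcon
  -- Were `u` cofinal, a pseudointersection of the `y (u i)` would be almost contained in every `y
  -- α`, leaving no gaps along its points.
  obtain ⟨a, ha, hay⟩ := exists_injective_seq_eventually_mem (X := ℕ) (I := ℕ)
    (by simpa using hp) (fun i => y (u i)) (by
      intro t
      obtain ⟨N, hN⟩ : ∃ N, ∀ i ∈ t, i ≤ N := ⟨t.sup id, fun i hi => Finset.le_sup (f := id) hi⟩
      have hfin : (⋃ i ∈ t, y (u N) \ y (u i)).Finite :=
        t.finite_toSet.biUnion fun i hi => hy.finite_diff (hu (hN i hi))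
      refine ((hy.infinite (u N)).sdiff hfin).mono ?_
      rintro n ⟨hn, hn'⟩
      simp only [mem_iInter]
      intro i hi
      by_contra hni
      exact hn' (mem_biUnion (Finset.mem_coe.mpr hi) ⟨hn, hni⟩))
  have hmem : ∀ α, ∀ᶠ j in atTop, a j ∈ y α := by
    intro α
    obtain ⟨i, hi⟩ := hcon α
    have hfin := (hy.finite_diff hi).preimage ha.injOn
    have := hfin.compl_mem_cofinite
    rw [Nat.cofinite_eq_atTop] at this
    filter_upwards [this, hay i] with j hj hj'
    by_contra hja
    exact hj ⟨hj', hja⟩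
  have hinf : Tendsto a atTop atTop := by
    rw [← Nat.cofinite_eq_atTop]; exact ha.tendsto_cofinite
  obtain ⟨α, hα⟩ := hy.exists_gaps_along (h := fun j => a j + 1) hinf
  obtain ⟨j, hj, hj'⟩ := (hα.and_eventually (hmem α)).exists
  exact Set.disjoint_left.mp hj hj' ⟨le_rfl, Nat.lt_succ_self _⟩

end IsUnboundedTower

/-! ### Diagonal sequences from a tower -/

namespace IsUnboundedTower

variable {ι : Type} [LinearOrder ι] {y : ι → Set ℕ}

/-- Fewer than `𝔭` sets `G β` are met by one sequence; passing to the terms at which a later tower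
set has a gap keeps this. -/
theorem exists_seq_of_initial_segment (hy : IsUnboundedTower y)
    (hb : Cardinal.aleph0 < pseudointersectionNumber)
    (hι : ∀ α : ι, Cardinal.mk (Iio α) < pseudointersectionNumber)
    {X : Type} [Countable X] [Infinite X] {L : Filter X} [NeBot L] {A : Set X} (hA : A ∈ L)
    {l h : X → ℕ} (hl : Tendsto l L atTop) {G : ι → Set X} (hG : ∀ γ, G γ ∈ L) (α : ι) :
    ∃ α' > α, ∃ b : ℕ → X, (∀ j, b j ∈ A ∧ Disjoint (y α') (Ico (l (b j)) (h (b j)))) ∧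
      Tendsto (fun j => l (b j)) atTop atTop ∧ ∀ β < α, ∀ᶠ j in atTop, b j ∈ G β := by
  obtain ⟨a, -, ha⟩ := exists_injective_seq_eventually_mem (X := X) (I := Iio α ⊕ ℕ)
    (by
      rw [Cardinal.mk_sum, Cardinal.lift_id, Cardinal.lift_id]
      exact Cardinal.add_lt_of_lt hb.le (hι α) (by simpa using hb))
    (Sum.elim (fun β => G β.1) fun M => A ∩ {a | M ≤ l a}) (by
      intro t
      have hmem : (⋂ i ∈ t, Sum.elim (fun β : Iio α => G β.1) (fun M => A ∩ {a | M ≤ l a}) i)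
          ∈ L := by
        rw [biInter_finset_mem]
        rintro (β | M) -
        · exact hG _
        · exact inter_mem hA (hl.eventually_ge_atTop M)
      intro hfin
      obtain ⟨M, hM⟩ := (hfin.image l).bddAbove
      obtain ⟨x, hx, hx'⟩ := Filter.nonempty_of_mem (inter_mem hmem (hl.eventually_gt_atTop M))
      exact absurd (hM (mem_image_of_mem l hx)) (not_le.mpr hx'))
  have hla : Tendsto (fun j => l (a j)) atTop atTop :=
    tendsto_atTop.mpr fun M => (ha (Sum.inr M)).mono fun j hj => hj.2
  obtain ⟨α₀, hα₀⟩ := hy.exists_gaps_along (h := fun j => h (a j)) hla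
  obtain ⟨α', hα'⟩ := hy.exists_forall_lt hb (fun _ => max α α₀) monotone_const
  have hlt := max_lt_iff.mp (hα' 0)
  obtain ⟨M, hM⟩ := hy.eventually_disjoint hlt.2.le
  obtain ⟨φ, hφ, hφ'⟩ := extraction_of_frequently_atTop
    ((hα₀.and_eventually (hla.eventually_ge_atTop M)).and_eventually (ha (Sum.inr 0)))
  exact ⟨α', hlt.1, a ∘ φ, fun j => ⟨(hφ' j).2.1, hM _ _ (hφ' j).1.2 (hφ' j).1.1⟩,
    hla.comp hφ.tendsto_atTop, fun β hβ => hφ.tendsto_atTop.eventually (ha (Sum.inl ⟨β, hβ⟩))⟩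

/-- If membership in each of the sets `G γ` of a filter follows, far along the filter, from a gap
of `y γ`, then some sequence is eventually in all of the `G γ`. -/
theorem exists_seq_eventually_mem [WellFoundedLT ι] (hy : IsUnboundedTower y)
    (hpb : pseudointersectionNumber = boundingNumber)
    (hι : ∀ α : ι, Cardinal.mk (Iio α) < boundingNumber)
    {X : Type} [Countable X] [Infinite X] {L : Filter X} [NeBot L] {A : Set X} (hA : A ∈ L)
    {l h : X → ℕ} (hl : Tendsto l L atTop) {G : ι → Set X} (hG : ∀ γ, G γ ∈ L)
    (hgap : ∀ γ, ∃ M, ∀ a ∈ A, M ≤ l a → Disjoint (y γ) (Ico (l a) (h a)) → a ∈ G γ) :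
    ∃ c : ℕ → X, (∀ i, c i ∈ A) ∧ Tendsto (fun i => l (c i)) atTop atTop ∧
      ∀ γ, ∀ᶠ i in atTop, c i ∈ G γ := by
  have hb : Cardinal.aleph0 < pseudointersectionNumber := hpb ▸ aleph0_lt_boundingNumber
  have step := hy.exists_seq_of_initial_segment hb (by rwa [hpb]) hA (h := h) hl hG
  choose s hs b hbA hbl hbG using step
  obtain ⟨α₀, -⟩ := hy.exists_gaps id strictMono_id
  let u : ℕ → ι := fun n => s^[n] α₀
  have hu : ∀ n, u (n + 1) = s (u n) := fun n => Function.iterate_succ_apply' s n α₀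
  have hmono : StrictMono u := strictMono_nat_of_lt_succ fun n => by rw [hu]; exact hs _
  -- `δ` is the supremum of the `u i`. Indices below `δ` are handled by domination, the others by
  -- gaps of `y δ`.
  obtain ⟨δ, hδ, hmin⟩ : ∃ δ, (∀ i, u i < δ) ∧ ∀ β < δ, ∃ i, β ≤ u i := by
    have hne := hy.exists_forall_lt hb u hmono.monotone
    refine ⟨wellFounded_lt.min {δ | ∀ i, u i < δ} hne,
      wellFounded_lt.min_mem {δ | ∀ i, u i < δ} hne, fun β hβ => ?_⟩
    by_contra! hcon
    exact wellFounded_lt.not_lt_min {δ | ∀ i, u i < δ} hcon hβ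
  have hN : ∀ (β : Iio δ) (i : ℕ), ∃ N, β.1 < u i → ∀ j ≥ N, b (u i) j ∈ G β.1 := by
    intro β i
    by_cases hβ : β.1 < u i
    · obtain ⟨N, hN⟩ := eventually_atTop.mp (hbG (u i) β.1 hβ)
      exact ⟨N, fun _ => hN⟩
    · exact ⟨0, fun h => absurd h hβ⟩
  choose N hN using hN
  -- Fewer than `𝔟` thresholds, one function for each `β < δ`, are dominated by a single `g`, so
  -- going past `g i` in the `i`-th sequence serves them all.
  obtain ⟨g, hg⟩ := exists_eventual_bound (hι δ) N
  have hJ : ∀ i, ∃ j, g i ≤ j ∧ i ≤ l (b (u i) j) ∧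
      Disjoint (y δ) (Ico (l (b (u i) j)) (h (b (u i) j))) := by
    intro i
    obtain ⟨M, hM⟩ := hy.eventually_disjoint (hδ (i + 1)).le
    obtain ⟨j, hj1, hj2, hj3⟩ := ((eventually_ge_atTop (g i)).and
      (((hbl (u i)).eventually_ge_atTop i).and ((hbl (u i)).eventually_ge_atTop M))).exists
    refine ⟨j, hj1, hj2, hM _ _ hj3 ?_⟩
    rw [hu]
    exact (hbA (u i) j).2
  choose J hgJ hlJ hJd using hJ
  have hlc : Tendsto (fun i => l (b (u i) (J i))) atTop atTop :=
    tendsto_atTop_mono hlJ tendsto_id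
  refine ⟨fun i => b (u i) (J i), fun i => (hbA _ _).1, hlc, fun γ => ?_⟩
  rcases lt_or_ge γ δ with hγ | hγ
  · obtain ⟨i₀, hi₀⟩ := hmin γ hγ
    filter_upwards [hg ⟨γ, hγ⟩, eventually_gt_atTop i₀] with i hi hii
    exact hN ⟨γ, hγ⟩ i (hi₀.trans_lt (hmono hii)) _ (hi.trans (hgJ i))
  · obtain ⟨M, hM⟩ := hy.eventually_disjoint hγ
    obtain ⟨M', hM'⟩ := hgap γ
    filter_upwards [hlc.eventually_ge_atTop M, hlc.eventually_ge_atTop M'] with i hi hi'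
    exact hM' _ (hbA _ _).1 hi' (hM _ _ hi (hJd i))

end IsUnboundedTower

/-! ### Topologies given by two-valued coordinates -/

section Coordinates

variable {X I : Type} [TopologicalSpace X] {f : X → I → Bool}

theorem Topology.IsInducing.isClopen_coord (hf : Topology.IsInducing f) (i : I) (b : Bool) :
    IsClopen {x | f x i = b} :=
  (isClopen_discrete {b}).preimage ((continuous_apply i).comp hf.continuous)

theorem Topology.IsInducing.isClopen_agree (hf : Topology.IsInducing f) (x : X) (t : Finset I) :
    IsClopen {z | ∀ i ∈ t, f z i = f x i} := by
  have : {z | ∀ i ∈ t, f z i = f x i} = ⋂ i ∈ t, {z | f z i = f x i} := by ext; simp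
  rw [this]
  exact isClopen_biInter_finset fun i _ => hf.isClopen_coord i (f x i)

theorem Topology.IsInducing.isTopologicalBasis_agree (hf : Topology.IsInducing f) :
    IsTopologicalBasis (range fun p : X × Finset I => {z | ∀ i ∈ p.2, f z i = f p.1 i}) := by
  refine isTopologicalBasis_of_isOpen_of_nhds ?_ fun x W hx hW => ?_
  · rintro _ ⟨p, rfl⟩
    exact (hf.isClopen_agree p.1 p.2).isOpen
  · obtain ⟨V, hV, rfl⟩ := hf.isOpen_iff.mp hW
    obtain ⟨t, u, hu, hsub⟩ := isOpen_pi_iff.mp hV (f x) hx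
    refine ⟨_, ⟨(x, t), rfl⟩, fun i _ => rfl, fun z hz => hsub fun i hi => ?_⟩
    have : f z i = f x i := hz i hi
    rw [this]
    exact (hu i hi).2

theorem Topology.IsInducing.isZeroDimensional (hf : Topology.IsInducing f) :
    IsZeroDimensional X := by
  refine hf.isTopologicalBasis_agree.of_isOpen_of_subset (fun s hs => hs.isOpen) ?_
  rintro _ ⟨p, rfl⟩
  exact hf.isClopen_agree p.1 p.2

theorem Topology.IsInducing.tendsto_coord_iff (hf : Topology.IsInducing f) {β : Type}
    {c : β → X} {L : Filter β} {x : X} :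
    Tendsto c L (nhds x) ↔ ∀ i, ∀ᶠ j in L, f (c j) i = f x i := by
  rw [hf.tendsto_nhds_iff, tendsto_pi_nhds]
  simp [nhds_discrete, tendsto_pure]

theorem Topology.IsInducing.piWeight_le (hf : Topology.IsInducing f) :
    piWeight X ≤ Cardinal.mk (X × Finset I) := by
  refine le_trans (csInf_le' ⟨range fun p : X × Finset I => {z | ∀ i ∈ p.2, f z i = f p.1 i},
    ⟨?_, fun W hW hne => ?_⟩, rfl⟩) Cardinal.mk_range_le
  · rintro _ ⟨p, rfl⟩
    exact ⟨(hf.isClopen_agree p.1 p.2).isOpen, p.1, fun _ _ => rfl⟩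
  · obtain ⟨x, hx⟩ := hne
    obtain ⟨U, hU, -, hUW⟩ := hf.isTopologicalBasis_agree.exists_subset_of_mem_open hx hW
    exact ⟨U, hU, hUW⟩

end Coordinates

/-! ### Countable spaces of small π-weight are H-separable -/

/-- Enumerate `X`. Each member of the π-base gives a function bounding where it meets `D n`; a
common eventual bound `g` says how much of `D n` to take. -/
theorem hSeparable_of_isPiBase {X : Type} [TopologicalSpace X] [Countable X] {B : Set (Set X)}
    (hB : IsPiBase X B) (hcard : Cardinal.mk B < boundingNumber) : HSeparable X := by
  intro D hD
  obtain ⟨e, he⟩ := exists_injective_nat X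
  have hex : ∀ (U : B) (n : ℕ), ∃ x, x ∈ U.1 ∧ x ∈ D n := fun U n =>
    (hD n).inter_open_nonempty _ (hB.1 U.1 U.2).1 (hB.1 U.1 U.2).2
  choose d hdU hdD using hex
  obtain ⟨g, hg⟩ := exists_eventual_bound hcard fun U n => e (d U n)
  have hfin : ∀ n, {x | x ∈ D n ∧ e x ≤ g n}.Finite := fun n =>
    ((finite_Iic (g n)).preimage he.injOn).subset fun x hx => hx.2
  refine ⟨fun n => (hfin n).toFinset, fun n x hx => ?_, fun A hA => ?_⟩
  · exact ((hfin n).mem_toFinset.mp hx).1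
  · rw [dense_iff_inter_open]
    intro W hW hne
    obtain ⟨U, hU, hUW⟩ := hB.2 W hW hne
    obtain ⟨n, hn, hnA⟩ :=
      ((hg ⟨U, hU⟩).and_frequently (Nat.frequently_atTop_iff_infinite.mpr hA)).exists
    refine ⟨d ⟨U, hU⟩ n, hUW (hdU ⟨U, hU⟩ n), mem_biUnion hnA ?_⟩
    exact (hfin n).mem_toFinset.mpr ⟨hdD _ _, hn⟩

theorem boundingNumber_le_piWeight {X : Type} [TopologicalSpace X] [Countable X]
    (hX : ¬ HSeparable X) : boundingNumber ≤ piWeight X := by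
  refine le_csInf ⟨_, {U | IsOpen U ∧ U.Nonempty}, ⟨fun U hU => hU, fun W hW hne =>
    ⟨W, ⟨hW, hne⟩, subset_rfl⟩⟩, rfl⟩ ?_
  rintro _ ⟨B, hB, rfl⟩
  by_contra hlt
  exact hX (hSeparable_of_isPiBase hB (not_le.mp hlt))

/-! ### The space of a tower -/

/-- A strictly increasing measure of finite sequences of pairs; the head is the last entry. -/
def height : List (ℕ × ℕ) → ℕ
  | [] => 0
  | p :: S => height S + p.1 + p.2 + 1

open scoped Classical in
/-- The first component is the value of the coordinate function of `y` at a sequence; the second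
is the value at the longest proper initial part whose extension by one entry crosses an element
of `y`. -/
noncomputable def valuePair (y : Set ℕ) : List (ℕ × ℕ) → Prop × Prop
  | [] => (True, True)
  | p :: S =>
    let v := if (y ∩ Ico (height S) (height (p :: S))).Nonempty then (valuePair y S).1
      else (valuePair y S).2
    (¬(p.1 ∈ y ∧ Disjoint y (Ioo p.1 (height (p :: S)))) ∧ v, v)

/-- The coordinate function of `y`. -/
def Holds (y : Set ℕ) (S : List (ℕ × ℕ)) : Prop := (valuePair y S).1

/-- The first component of the last entry of a sequence. -/
def lastFst : List (ℕ × ℕ) → ℕ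
  | [] => 0
  | p :: _ => p.1

theorem holds_nil (y : Set ℕ) : Holds y [] := trivial

theorem holds_cons (y : Set ℕ) (p : ℕ × ℕ) (S : List (ℕ × ℕ)) :
    Holds y (p :: S) ↔
      ¬(p.1 ∈ y ∧ Disjoint y (Ioo p.1 (height (p :: S)))) ∧ (valuePair y (p :: S)).2 :=
  Iff.rfl

theorem height_le_append (R S : List (ℕ × ℕ)) : height S ≤ height (R ++ S) := by
  induction R with
  | nil => rfl
  | cons q R ih => simp only [List.cons_append, height]; omega

theorem valuePair_snd_of_meets {y : Set ℕ} {p : ℕ × ℕ} {S : List (ℕ × ℕ)}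
    (h : (y ∩ Ico (height S) (height (p :: S))).Nonempty) :
    (valuePair y (p :: S)).2 = Holds y S := by
  simp only [valuePair, if_pos h, Holds]

/-- No entry of `R` crosses an element of `y`, so each passes the inherited value on unchanged. -/
theorem valuePair_snd_append {y : Set ℕ} {p : ℕ × ℕ} {S : List (ℕ × ℕ)}
    (h : (y ∩ Ico (height S) (height (p :: S))).Nonempty) (R : List (ℕ × ℕ))
    (hR : Disjoint y (Ico (height (p :: S)) (height (R ++ p :: S)))) :
    (valuePair y (R ++ p :: S)).2 = Holds y S := by
  induction R with
  | nil => exact valuePair_snd_of_meets h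
  | cons q R ih =>
    have hle : height (R ++ p :: S) ≤ height (q :: (R ++ p :: S)) := height_le_append [q] _
    have hne : ¬ (y ∩ Ico (height (R ++ p :: S)) (height (q :: (R ++ p :: S)))).Nonempty := by
      rw [not_nonempty_iff_eq_empty, ← disjoint_iff_inter_eq_empty]
      exact hR.mono_right (Ico_subset_Ico_left (height_le_append R _))
    rw [← ih (hR.mono_right (Ico_subset_Ico_right hle))]
    simp only [List.cons_append, valuePair, if_neg hne]

/-- A gap of `y` between the height of `p :: S` and that of an extension `a` makes the values at
`a` and `S` agree. -/
theorem holds_append_iff {y : Set ℕ} {p : ℕ × ℕ} {S R : List (ℕ × ℕ)}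
    (h : (y ∩ Ico (height S) (height (p :: S))).Nonempty)
    (hR : Disjoint y (Ico (height (p :: S)) (height (R ++ p :: S))))
    (hlast : lastFst (R ++ p :: S) ∈ y →
      (y ∩ Ioo (lastFst (R ++ p :: S)) (height (R ++ p :: S))).Nonempty) :
    Holds y (R ++ p :: S) ↔ Holds y S := by
  rw [← valuePair_snd_append h R hR]
  cases R with
  | nil =>
    rw [List.nil_append, holds_cons, and_iff_right]
    rintro ⟨h1, h2⟩
    exact (hlast h1).ne_empty (disjoint_iff_inter_eq_empty.mp h2)
  | cons q R =>
    rw [List.cons_append, holds_cons, and_iff_right]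
    rintro ⟨h1, h2⟩
    exact (hlast h1).ne_empty (disjoint_iff_inter_eq_empty.mp h2)

/-- A large `m` makes the new entry cross an element of `y` beyond `n`, so it inherits from `S` and
is not itself a failure. -/
theorem eventually_holds_cons_iff {y : Set ℕ} (hy : y.Infinite) (n : ℕ) (S : List (ℕ × ℕ)) :
    ∀ᶠ m in atTop, (Holds y ((n, m) :: S) ↔ Holds y S) := by
  obtain ⟨k, hk, hlt⟩ := hy.exists_gt (height S + n)
  filter_upwards [eventually_gt_atTop k] with m hm
  have hkm : k < height ((n, m) :: S) := by simp only [height]; omega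
  exact holds_append_iff (R := []) ⟨k, hk, by omega, hkm⟩ (by simp)
    fun _ => ⟨k, hk, by simp only [List.nil_append, lastFst]; omega, hkm⟩

/-- The point set of the space of the family `y`. -/
@[ext]
structure TowerSpace {ι : Type} (y : ι → Set ℕ) : Type where
  /-- The finite sequence of pairs underlying a point. -/
  seq : List (ℕ × ℕ)

/-! ### Topology of the tower space -/

namespace TowerSpace

variable {ι : Type} {y : ι → Set ℕ}

open scoped Classical in
/-- The coordinates of a point of the space of the family `y`. -/
noncomputable def coord (y : ι → Set ℕ) (S : TowerSpace y) : List (ℕ × ℕ) ⊕ ι → Bool :=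
  Sum.elim (fun R => decide (R <:+ S.seq)) fun γ => decide (Holds (y γ) S.seq)

noncomputable instance : TopologicalSpace (TowerSpace y) :=
  TopologicalSpace.induced (coord y) inferInstance

instance : Countable (TowerSpace y) := 
  Function.Injective.countable (f := seq) fun _ _ => TowerSpace.ext

instance : Infinite (TowerSpace y) := 
  Infinite.of_injective (mk (y := y)) fun _ _ => congrArg seq

theorem isInducing_coord : Topology.IsInducing (coord y) := ⟨rfl⟩

theorem coord_injective : Function.Injective (coord y) := by
  intro S S' h
  have h1 := congrFun h (Sum.inl S.seq)
  have h2 := congrFun h (Sum.inl S'.seq)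
  simp only [coord, Sum.elim_inl, decide_eq_decide] at h1 h2
  exact TowerSpace.ext ((h1.mp (List.suffix_refl _)).eq_of_length_le
    (h2.mpr (List.suffix_refl _)).length_le)

instance : T2Space (TowerSpace y) :=
  T2Space.of_injective_continuous coord_injective isInducing_coord.continuous

theorem tendsto_iff {β : Type} {c : β → TowerSpace y} {L : Filter β} {S : List (ℕ × ℕ)} :
    Tendsto c L (nhds ⟨S⟩) ↔
      (∀ R, ∀ᶠ j in L, (R <:+ (c j).seq ↔ R <:+ S)) ∧
        ∀ γ, ∀ᶠ j in L, (Holds (y γ) (c j).seq ↔ Holds (y γ) S) := by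
  rw [isInducing_coord.tendsto_coord_iff, Sum.forall]
  simp [coord]

theorem tendsto_cons (hy : ∀ γ, (y γ).Infinite) (n : ℕ) (S : List (ℕ × ℕ)) :
    Tendsto (fun m => (⟨(n, m) :: S⟩ : TowerSpace y)) atTop (nhds ⟨S⟩) := by
  refine tendsto_iff.mpr ⟨fun R => ?_, fun γ => eventually_holds_cons_iff (hy γ) n S⟩
  filter_upwards [eventually_gt_atTop (height R)] with m hm
  rw [List.suffix_cons_iff, or_iff_right]
  rintro rfl
  simp only [height] at hm
  omega

theorem not_hSeparable [LinearOrder ι] (hy : IsUnboundedTower y) :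
    ¬ HSeparable (TowerSpace y) := by
  intro H
  obtain ⟨F, hFD, hF⟩ := H (fun n => {a | ∃ m S, a = ⟨(n, m) :: S⟩}) (by
    rintro n ⟨S⟩
    refine mem_closure_of_tendsto (tendsto_cons hy.infinite n S) ?_
    exact Eventually.of_forall fun m => ⟨m, S, rfl⟩)
  let g : ℕ → ℕ := fun n => (F n).sup fun a => height a.seq
  obtain ⟨α, hα⟩ := hy.exists_gaps_along (l := id) (h := fun j => (Finset.range j).sup g)
    tendsto_id
  have hA : {n | n ∈ y α ∧ Disjoint (y α) (Ioo n (g n))}.Infinite := by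
    rw [infinite_iff_exists_gt]
    intro N
    obtain ⟨k, hk, hNk⟩ := (hy.infinite α).exists_gt N
    obtain ⟨j, hj, hkj⟩ := (hα.and_eventually (eventually_gt_atTop k)).exists
    -- The last element `n` of `y α` before a gap starting at `j`; the gap reaches past `g n`
    -- because `n < j`.
    obtain ⟨n, ⟨hn, hnj⟩, hmax⟩ := ((finite_Iio j).inter_of_right (y α)).exists_maximal ⟨k, hk, hkj⟩
    have hle : ∀ n' ∈ y α, n' < j → n' ≤ n := fun n' h1 h2 => by
      by_contra hlt
      exact hlt (hmax ⟨h1, h2⟩ (not_le.mp hlt).le)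
    refine ⟨n, ⟨hn, Set.disjoint_left.mpr fun n' hn' hlt => ?_⟩, hNk.trans_le (hle k hk hkj)⟩
    refine Set.disjoint_left.mp hj hn' ⟨?_, hlt.2.trans_le ?_⟩
    · by_contra hcon
      exact absurd (hle n' hn' (not_le.mp hcon)) (not_le.mpr hlt.1)
    · exact Finset.le_sup (f := g) (Finset.mem_range.mpr hnj)
  have hopen : IsOpen {S : TowerSpace y | coord y S (Sum.inr α) = true} :=
    (isInducing_coord.isClopen_coord _ _).isOpen
  obtain ⟨a, ha, haF⟩ := (hF _ hA).inter_open_nonempty _ hopen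
    ⟨⟨[]⟩, by simpa [coord] using holds_nil (y α)⟩
  obtain ⟨n, ⟨hn, hdisj⟩, han⟩ := mem_iUnion₂.mp haF
  obtain ⟨m, S, rfl⟩ := hFD n han
  have hhold : Holds (y α) ((n, m) :: S) := by simpa [coord] using ha
  refine ((holds_cons _ _ _).mp hhold).1 ⟨hn, hdisj.mono_right (Ioo_subset_Ioo_right ?_)⟩
  exact Finset.le_sup (f := fun a : TowerSpace y => height a.seq) (Finset.mem_coe.mp han)

/-- The height of the initial part of `a` that is one entry longer than `S`. -/
def branchHeight (S a : List (ℕ × ℕ)) : ℕ := height (a.drop (a.length - S.length - 1))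

theorem branchHeight_append (S R : List (ℕ × ℕ)) (p : ℕ × ℕ) :
    branchHeight S (R ++ p :: S) = height (p :: S) := by
  have : (R ++ p :: S).length - S.length - 1 = R.length := by
    simp only [List.length_append, List.length_cons]; omega
  rw [branchHeight, this, List.drop_left]

theorem exists_eq_append_cons {S a : List (ℕ × ℕ)} (h : List.IsSuffix S a) (hne : a ≠ S) :
    ∃ R p, a = R ++ p :: S := by
  obtain ⟨t, rfl⟩ := h
  rcases List.eq_nil_or_concat t with rfl | ⟨R, p, rfl⟩
  · exact absurd rfl hne
  · exact ⟨R, p, by simp⟩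

theorem tendsto_branchHeight {L : Filter (TowerSpace y)} {S : List (ℕ × ℕ)}
    (hL : L ≤ nhds ⟨S⟩) (hne : ∀ᶠ a in L, ∃ R p, a.seq = R ++ p :: S) :
    Tendsto (fun a => branchHeight S a.seq) L atTop := by
  rw [tendsto_atTop]
  intro M
  -- Only finitely many entries `p` give `p :: S` small height, and each is excluded near `S` by its
  -- own coordinate.
  have hfin : ∀ᶠ a in L, ∀ p ∈ (Finset.range M ×ˢ Finset.range M : Finset (ℕ × ℕ)),
      (p :: S <:+ a.seq ↔ p :: S <:+ S) :=
    (Finset.eventually_all _).mpr fun p _ => (tendsto_iff.mp (tendsto_id'.mpr hL)).1 (p :: S)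
  filter_upwards [hne, hfin] with a ha hfin
  obtain ⟨R, p, hRp⟩ := ha
  rw [hRp, branchHeight_append]
  by_contra hlt
  simp only [height] at hlt
  have hp : p ∈ (Finset.range M ×ˢ Finset.range M : Finset (ℕ × ℕ)) := by
    rw [Finset.mem_product, Finset.mem_range, Finset.mem_range]; omega
  have := ((hfin p hp).mp (hRp ▸ List.suffix_append _ _)).length_le
  simp at this

theorem tendsto_of_branchHeight {c : ℕ → TowerSpace y} {S : List (ℕ × ℕ)}
    (hc : ∀ i, ∃ R p, (c i).seq = R ++ p :: S)
    (hlim : Tendsto (fun i => branchHeight S (c i).seq) atTop atTop)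
    (hG : ∀ γ, ∀ᶠ i in atTop, (Holds (y γ) (c i).seq ↔ Holds (y γ) S)) :
    Tendsto c atTop (nhds ⟨S⟩) := by
  refine tendsto_iff.mpr ⟨fun Q => ?_, hG⟩
  filter_upwards [hlim.eventually_gt_atTop (height Q)] with i hi
  obtain ⟨R, p, hRp⟩ := hc i
  rw [hRp] at hi ⊢
  rw [branchHeight_append] at hi
  constructor
  · intro hQ
    rcases List.suffix_or_suffix_of_suffix hQ (List.suffix_append R (p :: S)) with h | h
    · rcases List.suffix_cons_iff.mp h with rfl | h
      · exact absurd hi (lt_irrefl _)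
      · exact h
    · obtain ⟨t, rfl⟩ := h
      exact absurd (height_le_append t (p :: S)) (not_le.mpr hi)
  · exact fun hQ => (hQ.trans (List.suffix_cons p S)).trans (List.suffix_append _ _)

theorem frechetUrysohnSpace [LinearOrder ι] [WellFoundedLT ι] (hy : IsUnboundedTower y)
    (hpb : pseudointersectionNumber = boundingNumber)
    (hι : ∀ α : ι, Cardinal.mk (Iio α) < boundingNumber) :
    FrechetUrysohnSpace (TowerSpace y) := by
  refine ⟨fun A ⟨S⟩ hS => ?_⟩
  by_cases hSA : ⟨S⟩ ∈ A
  · exact ⟨fun _ => ⟨S⟩, fun _ => hSA, tendsto_const_nhds⟩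
  have hne : NeBot (nhdsWithin ⟨S⟩ A) := mem_closure_iff_nhdsWithin_neBot.mp hS
  -- Along an ultrafilter `lastFst` is either eventually constant or tends to infinity, which is the
  -- dichotomy needed for `l`.
  let U : Ultrafilter (TowerSpace y) := Ultrafilter.of (nhdsWithin ⟨S⟩ A)
  have hU : (U : Filter (TowerSpace y)) ≤ nhdsWithin ⟨S⟩ A := Ultrafilter.of_le _
  have hUS : (U : Filter (TowerSpace y)) ≤ nhds ⟨S⟩ := hU.trans nhdsWithin_le_nhds
  have hUA : A ∈ (U : Filter (TowerSpace y)) := hU self_mem_nhdsWithin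
  have hU' := tendsto_iff.mp (tendsto_id'.mpr hUS)
  have hext : ∀ᶠ a in (U : Filter (TowerSpace y)), ∃ R p, a.seq = R ++ p :: S := by
    filter_upwards [hU'.1 S, hUA] with a ha haA
    exact exists_eq_append_cons (ha.mpr (List.suffix_refl _)) (by rintro rfl; exact hSA haA)
  have hlim := tendsto_branchHeight hUS hext
  obtain ⟨l, n₀, hl, hlast⟩ : ∃ (l : TowerSpace y → ℕ) (n₀ : ℕ),
      Tendsto l (U : Filter (TowerSpace y)) atTop ∧
      ∀ᶠ a in (U : Filter (TowerSpace y)), l a ≤ branchHeight S a.seq ∧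
        (l a ≤ lastFst a.seq ∨ lastFst a.seq = n₀) := by
    by_cases hconst : ∃ n₀, ∀ᶠ a in (U : Filter (TowerSpace y)), lastFst a.seq = n₀
    · obtain ⟨n₀, hn₀⟩ := hconst
      exact ⟨_, n₀, hlim, hn₀.mono fun a ha => ⟨le_rfl, Or.inr ha⟩⟩
    · rw [not_exists] at hconst
      refine ⟨fun a => min (branchHeight S a.seq) (lastFst a.seq), 0, ?_,
        Eventually.of_forall fun a => ⟨min_le_left _ _, Or.inl (min_le_right _ _)⟩⟩
      refine tendsto_atTop.mpr fun M => ?_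
      have hfin : ∀ᶠ a in (U : Filter (TowerSpace y)), ∀ n ∈ Finset.range M, lastFst a.seq ≠ n :=
        (Finset.eventually_all _).mpr fun n _ => Ultrafilter.eventually_not.mpr (hconst n)
      filter_upwards [hfin, hlim.eventually_ge_atTop M] with a ha ha'
      refine le_min ha' ?_
      by_contra hlt
      exact ha _ (Finset.mem_range.mpr (not_le.mp hlt)) rfl
  obtain ⟨c, hcA, hcl, hcG⟩ := hy.exists_seq_eventually_mem hpb hι
    (L := (U : Filter (TowerSpace y))) (inter_mem hUA (inter_mem hext hlast)) (l := l)
    (h := fun a => height a.seq) hl (G := fun γ => {a | Holds (y γ) a.seq ↔ Holds (y γ) S}) hU'.2 (by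
      intro γ
      -- This `k` witnesses both that the first entry beyond `S` crosses `y γ` and, when `lastFst`
      -- is `n₀`, that `y γ` has an element after it. Otherwise `lastFst` lies in the gap, hence
      -- outside `y γ`.
      obtain ⟨k, hk, hk'⟩ := (hy.infinite γ).exists_gt (height S + n₀)
      refine ⟨k + 1, ?_⟩
      rintro a ⟨-, ⟨R, p, hRp⟩, hle, hor⟩ hM hd
      simp only [hRp] at hle hor hd
      rw [branchHeight_append] at hle
      have hpa := height_le_append R (p :: S)
      change Holds (y γ) a.seq ↔ Holds (y γ) S
      rw [hRp]
      refine holds_append_iff ⟨k, hk, by omega, by omega⟩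
        (hd.mono_right (Ico_subset_Ico_left hle)) fun hmem => ?_
      rcases hor with hor | hor
      · refine absurd ⟨hor, ?_⟩ (Set.disjoint_left.mp hd hmem)
        cases R <;> simp only [List.nil_append, List.cons_append, lastFst, height] <;> omega
      · rw [hor]
        exact ⟨k, hk, by omega, by omega⟩)
  exact ⟨c, fun i => (hcA i).1, tendsto_of_branchHeight (fun i => (hcA i).2.1)
    (tendsto_atTop_mono (fun i => (hcA i).2.2.1) hcl) hcG⟩

end TowerSpace

theorem theorem1p3 (h : pseudointersectionNumber = boundingNumber) :
    ∃ (X : Type) (_ : TopologicalSpace X),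
      Countable X ∧ T2Space X ∧ IsZeroDimensional X ∧ FrechetUrysohnSpace X ∧
        ¬ HSeparable X ∧ piWeight X = boundingNumber := by
  obtain ⟨y, hy⟩ := exists_isUnboundedTower h
  have hH := TowerSpace.not_hSeparable hy
  refine ⟨TowerSpace y, inferInstance, inferInstance, inferInstance,
    TowerSpace.isInducing_coord.isZeroDimensional,
    TowerSpace.frechetUrysohnSpace hy h mk_Iio_ord_toType_lt, hH,
    le_antisymm ?_ (boundingNumber_le_piWeight hH)⟩
  refine TowerSpace.isInducing_coord.piWeight_le.trans ?_
  have hb := aleph0_lt_boundingNumber.le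
  rw [Cardinal.mk_prod, Cardinal.lift_id, Cardinal.lift_id, Cardinal.mk_finset_of_infinite,
    Cardinal.mk_sum, Cardinal.lift_id, Cardinal.lift_id, Cardinal.mk_ord_toType]
  exact Cardinal.mul_le_of_le hb (Cardinal.mk_le_aleph0.trans hb)
    (Cardinal.add_le_of_le hb (Cardinal.mk_le_aleph0.trans hb) le_rfl)
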